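/- All fields have characteristic zero. Let $(F_n,\sigma)$ be a $\Sigma^*$-tower over a difference field $(F_0,\sigma)$ with constant field $C$: $\sigma$ is a field automorphism of $F_n$ that restricts to an automorphism of $F_0$, and there are fields $F_0\le F_1\le\dots\le F_n$ such that, for $1\le i\le n$, $F_i=F_{i-1}(t_i)$ with $t_i$ transcendental over $F_{i-1}$ and $\Delta(t_i)\in F_{i-1}$, where $\Delta(f)=\sigma(f)-f$; moreover $\{f\in F_n:\sigma(f)=f\}=\{f\in F_0:\sigma(f)=f\}=C$. A complete reduction for $\Delta(F_i)$ on $F_i$ is a $C$-linear map $\phi:F_i\to F_i$ with $f-\phi(f)\in\Delta(F_i)$ for all $f\in F_i$ and $\ker\phi=\Delta(F_i)$. Complete reductions $\phi_0,\dots,\phi_n$ along the tower are fixed as follows. Let $\phi_0$ be any complete reduction for $\Delta(F_0)$ on $F_0$, and let $\Theta_0$ be any $C$-basis of $F_0$. For $i\ge1$ let $\Theta_i$ be the $F_{i-1}$-basis of $F_i$ that consists of all $t_i^k$ with $k\ge 0$ and all $t_i^k/q^j$ with $q\in F_{i-1}[t_i]$ monic irreducible, $0\le k<\deg q$, $j\ge1$.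 Let $\Xi_i=\{\vartheta_0\vartheta_1\cdots\vartheta_i : \vartheta_j\in\Theta_j\}$, a $C$-basis of $F_i$. For $\theta\in\Xi_i$ let $\theta^*:F_i\to C$ be the $C$-linear map with $\theta^*(\theta)=1$ that vanishes on $\Xi_i\setminus\{\theta\}$. For $f\in F_n$ put $\operatorname{ind}(f)=\min\{i: f\in F_i\}$. For $1\le i\le n$, given $\phi_{i-1}$, choose * an element $\theta_i\in\Xi_{i-1}$ with $\theta_i^*(\phi_{i-1}(\Delta(t_i)))\ne0$ and $\operatorname{ind}(\theta_i)=\operatorname{ind}(\phi_{i-1}(\Delta(t_i)))$; * a set $S_i$ of representatives of the monic irreducible polynomials of $F_{i-1}[t_i]$ under the equivalence relation $p\sim q \iff p=c\,\sigma^{\ell}(q)$ for some $c\in F_{i-1}\setminus\{0\}$ and $\ell\in\mathbb Z$. Let $U_i$ be the set of all $a/d$ with $a\in F_{i-1}[t_i]$, $d$ a finite (possibly empty) product of elements of $S_i$, and $\deg a<\deg d$ (where $\deg 0=-\infty$). Let $V_i=\bigoplus_{k\ge0}\bigl(\operatorname{im}(\phi_{i-1})\cap\ker\theta_i^*\bigr)t_i^k$.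 Then $\phi_i$ is the complete reduction for $\Delta(F_i)$ on $F_i$ with image $U_i\oplus V_i$, that is, the projection onto $U_i\oplus V_i$ along $\Delta(F_i)$ in $F_i=\Delta(F_i)\oplus U_i\oplus V_i$. The tower is called well generated (with respect to these choices) if $\Delta(t_i)\in\operatorname{im}(\phi_{i-1})$ for all $1\le i\le n$. **Lemma.** Every well generated $\Sigma^*$-tower $(F_n,\sigma)$ over $(F_0,\sigma)$ is reduced over $F_0$: for every $1\le i\le n$, if there are $g_i\in F_{i-1}$ and $r_i\in F_0$ with $\Delta(t_i)=\Delta(g_i)+r_i$, then $\Delta(t_i)\in F_0$. -/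

import Mathlib

open scoped Polynomial IntermediateField

namespace SigmaTower

section LinearAlgebra

variable {R V : Type*} [Field R] [AddCommGroup V] [Module R V]

/-- A linear operator `φ` on `V` is a complete reduction for the subspace `U` if
`f - φ f ∈ U` for all `f`, and `ker φ = U`. -/
structure IsCompleteReduction (U : Submodule R V) (φ : V →ₗ[R] V) : Prop where
  sub_mem : ∀ f : V, f - φ f ∈ U
  ker_eq : LinearMap.ker φ = U

open Classical in
/-- The dual functional `θ^*` of a member `θ` of a basis `B` of `V`: the linear map with
`θ^* θ = 1` and `θ^* b = 0` for every other `b ∈ B`. (If `B` is a basis, there is exactly one such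
map; the value `0` is used only if there is none.) -/
noncomputable def dualFunctional (B : Set V) (θ : V) : V →ₗ[R] R :=
  if h : ∃ L : V →ₗ[R] R, ∀ b ∈ B, L b = if b = θ then 1 else 0 then h.choose else 0

end LinearAlgebra

variable {C E : Type*} [Field C] [Field E] [Algebra C E]

/-- The difference operator `Δ f = σ f - f`. -/
def delta (σ : E ≃ₐ[C] E) : E →ₗ[C] E := σ.toLinearMap - LinearMap.id

/-- The summable space `Δ(K)` of a subfield `K` with `σ(K) = K`, as a `C`-subspace of `K`. -/
def summableSpace (σ : E ≃ₐ[C] E) (K : IntermediateField C E) : Submodule C K :=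
  (K.toSubalgebra.toSubmodule.map (delta σ)).comap K.val.toLinearMap

/-- The fields `F_0 ≤ F_1 ≤ F_2 ≤ ⋯` with `F_{i+1} = F_i(t_i)`. The generators are numbered from
`0`, so that `t i` is a generator of `F_{i+1}` over `F_i`. -/
def towerField (F₀ : IntermediateField C E) (t : ℕ → E) : ℕ → IntermediateField C E
  | 0 => F₀
  | i + 1 => IntermediateField.restrictScalars C ((towerField F₀ t i)⟮t i⟯)

/-- `(E, σ)` is the `Σ^*`-tower `F_0(t_0, …, t_{n-1})` over the difference field `(F_0, σ)`, with
constant field `C`. The constants of `C ⊆ F_0` are fixed by `σ` because `σ` is `C`-linear. -/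
structure IsSigmaTower (σ : E ≃ₐ[C] E) (F₀ : IntermediateField C E) (t : ℕ → E) (n : ℕ) :
    Prop where
  base_stable : ∀ x : E, σ x ∈ F₀ ↔ x ∈ F₀
  top_eq : towerField F₀ t n = ⊤
  transcendental : ∀ i < n, Transcendental (towerField F₀ t i) (t i)
  delta_mem : ∀ i < n, delta σ (t i) ∈ towerField F₀ t i
  const_mem : ∀ x : E, σ x = x → x ∈ Set.range (algebraMap C E)

/-- `ind f = min {i | f ∈ F_i}`. -/
noncomputable def ind (F₀ : IntermediateField C E) (t : ℕ → E) (f : E) : ℕ :=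
  sInf {i : ℕ | f ∈ towerField F₀ t i}

/-- The canonical `K`-basis of `K(t)` for `t` transcendental over `K`: the powers `t^k`, and the
fractions `t^k / q^j` with `q ∈ K[t]` monic irreducible, `k < deg q` and `j ≥ 1`. -/
def fractionBasis (K : IntermediateField C E) (t : E) : Set E :=
  {x | ∃ k : ℕ, x = t ^ k} ∪
  {x | ∃ (q : K[X]) (k j : ℕ), q.Monic ∧ Irreducible q ∧ k < q.natDegree ∧ 0 < j ∧
    x = t ^ k / Polynomial.aeval t q ^ j}

/-- The canonical `C`-basis of `F_i` that belongs to a `C`-basis `Θ₀` of `F_0`: all products of a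
member of `Θ₀` and one member each of the canonical `F_j`-bases of `F_{j+1} = F_j(t_j)`, `j < i`. -/
def canonicalBasis {ι : Type*} {F₀ : IntermediateField C E} (Θ₀ : Module.Basis ι C F₀)
    (t : ℕ → E) : ℕ → Set E
  | 0 => Set.range fun j : ι => (Θ₀ j : E)
  | i + 1 => {x | ∃ ξ ∈ canonicalBasis Θ₀ t i,
      ∃ η ∈ fractionBasis (towerField F₀ t i) (t i), x = ξ * η}

/-- The `C`-linear functional `θ^* : F_i → C` for a member `θ` of the canonical basis of `F_i`. -/
noncomputable def thetaStar {ι : Type*} {F₀ : IntermediateField C E} (Θ₀ : Module.Basis ι C F₀)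
    (t : ℕ → E) (i : ℕ) (θ : towerField F₀ t i) : towerField F₀ t i →ₗ[C] C :=
  dualFunctional {ξ : towerField F₀ t i | (ξ : E) ∈ canonicalBasis Θ₀ t i} θ

/-- `p, q ∈ K[t]` are `σ`-equivalent: `p = c σ^ℓ(q)` with `c ∈ K` nonzero and `ℓ` an integer. -/
def SigmaEquivalent (σ : E ≃ₐ[C] E) (K : IntermediateField C E) (t : E) (p q : K[X]) : Prop :=
  ∃ (c : K) (l : ℤ), c ≠ 0 ∧
    Polynomial.aeval t p = (c : E) * (σ ^ l) (Polynomial.aeval t q)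

/-- `S` is a set of representatives of the `σ`-equivalence classes on the set of all monic
irreducible polynomials of `K[t]`. -/
structure IsRepresentativeSet (σ : E ≃ₐ[C] E) (K : IntermediateField C E) (t : E)
    (S : Set K[X]) : Prop where
  monic_irreducible : ∀ p ∈ S, p.Monic ∧ Irreducible p
  existsUnique : ∀ q : K[X], q.Monic → Irreducible q → ∃! p, p ∈ S ∧ SigmaEquivalent σ K t p q

/-- `U_S`: the `t`-proper elements `a / d` of `K(t)` whose denominator `d` is a (possibly empty)
product of members of `S`. -/
def properComplement (K : IntermediateField C E) (t : E) (S : Set K[X]) : Set E :=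
  {x | ∃ a d : K[X], d ∈ Submonoid.closure S ∧ a.degree < d.degree ∧
    x = Polynomial.aeval t a / Polynomial.aeval t d}

/-- `V_θ`: the polynomials in `t` with all coefficients in `im φ ∩ ker θ^*`; here `L = θ^*`. -/
def polyComplement (K : IntermediateField C E) (t : E) (φ : K →ₗ[C] K) (L : K →ₗ[C] C) : Set E :=
  {x | ∃ p : K[X], (∀ k : ℕ, p.coeff k ∈ LinearMap.range φ ∧ L (p.coeff k) = 0) ∧
    x = Polynomial.aeval t p}

/-- `φ 0, …, φ n` are the complete reductions on `F_0, …, F_n` that are constructed recursively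
along the tower. `φ 0` is any complete reduction for `Δ(F_0)`. Given `φ i`, choose a member `θ i` of
the canonical basis of `F_i` that is effective for `φ i (Δ t_i)` and has the same index, and a set
`S i` of representatives of the monic irreducible polynomials of `F_i[t_i]`; then `φ (i+1)` is the
complete reduction for `Δ(F_{i+1})` that belongs to the decomposition
`F_{i+1} = Δ(F_{i+1}) ⊕ U_S ⊕ V_θ`. -/
structure IsReductionSystem {ι : Type*} (σ : E ≃ₐ[C] E) (F₀ : IntermediateField C E) (t : ℕ → E)
    (n : ℕ) (Θ₀ : Module.Basis ι C F₀) (S : ∀ i : ℕ, Set (towerField F₀ t i)[X])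
    (θ : ∀ i : ℕ, towerField F₀ t i)
    (φ : ∀ i : ℕ, towerField F₀ t i →ₗ[C] towerField F₀ t i) : Prop where
  completeReduction : ∀ i ≤ n, IsCompleteReduction (summableSpace σ (towerField F₀ t i)) (φ i)
  representatives : ∀ i < n, IsRepresentativeSet σ (towerField F₀ t i) (t i) (S i)
  theta_mem : ∀ i < n, (θ i : E) ∈ canonicalBasis Θ₀ t i
  theta_effective : ∀ i < n, ∀ a : towerField F₀ t i, (a : E) = delta σ (t i) →
    thetaStar Θ₀ t i (θ i) (φ i a) ≠ 0
  theta_ind : ∀ i < n, ∀ a : towerField F₀ t i, (a : E) = delta σ (t i) →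
    ind F₀ t (θ i) = ind F₀ t (φ i a)
  range_succ : ∀ i < n, ∀ x : towerField F₀ t (i + 1), x ∈ LinearMap.range (φ (i + 1)) ↔
    ∃ u ∈ properComplement (towerField F₀ t i) (t i) (S i),
      ∃ v ∈ polyComplement (towerField F₀ t i) (t i) (φ i) (thetaStar Θ₀ t i (θ i)),
        (x : E) = u + v

/-- The tower is well generated with respect to `φ`: `Δ(t_i) ∈ im (φ i)` for each `i < n`. -/
def IsWellGenerated (σ : E ≃ₐ[C] E) (F₀ : IntermediateField C E) (t : ℕ → E) (n : ℕ)
    (φ : ∀ i : ℕ, towerField F₀ t i →ₗ[C] towerField F₀ t i) : Prop :=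
  ∀ i < n, ∃ y ∈ LinearMap.range (φ i), (y : E) = delta σ (t i)

/-- The tower is reduced over `F_0`. -/
def IsReduced (σ : E ≃ₐ[C] E) (F₀ : IntermediateField C E) (t : ℕ → E) (n : ℕ) : Prop :=
  ∀ i < n, (∃ g ∈ towerField F₀ t i, ∃ r ∈ F₀, delta σ (t i) = delta σ g + r) →
    delta σ (t i) ∈ F₀

end SigmaTower

/-!
The reduction `φ (i + 1)` restricted to `F_i` differs from `φ i` only by subtracting the multiple of
`Δ t_i` that makes `θ_i^*` vanish. For an argument in `F_0` this multiple stays in `F_0`: either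
`Δ t_i ∈ F_0`, or `θ_i ∉ F_0` because `θ_i` and `Δ t_i` have the same index, and then `θ_i^*`
vanishes on `F_0` and the multiple is zero. By induction every `φ i` maps `F_0` into itself. Now if
`Δ t_i = Δ g + r` with `r ∈ F_0`, then applying `φ i`, which fixes `Δ t_i` and kills `Δ g`, gives
`Δ t_i = φ i r ∈ F_0`.
-/

namespace SigmaTower

section LinearAlgebra

variable {R V W : Type*} [Field R] [AddCommGroup V] [Module R V] [AddCommGroup W] [Module R W]

theorem dualFunctional_apply_of_ne {B : Set V} {θ b : V} (hb : b ∈ B) (hne : b ≠ θ) :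
    dualFunctional (R := R) B θ b = 0 := by
  unfold dualFunctional
  split_ifs with h
  · exact (h.choose_spec b hb).trans (if_neg hne)
  · rfl

namespace IsCompleteReduction

variable {U : Submodule R V} {φ : V →ₗ[R] V} {U' : Submodule R W} {ψ : W →ₗ[R] W}

theorem apply_eq_apply_iff (hφ : IsCompleteReduction U φ) {f g : V} : φ f = φ g ↔ f - g ∈ U := by
  rw [← hφ.ker_eq, LinearMap.sub_mem_ker_iff]

theorem mem_range_iff (hφ : IsCompleteReduction U φ) {f : V} :
    f ∈ LinearMap.range φ ↔ φ f = f := by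
  have hidem : IsIdempotentElem φ :=
    LinearMap.ext fun f => (hφ.apply_eq_apply_iff.2 (hφ.sub_mem f)).symm
  exact LinearMap.IsIdempotentElem.mem_range_iff hidem

theorem apply_map_eq (hφ : IsCompleteReduction U φ) (hψ : IsCompleteReduction U' ψ)
    {j : V →ₗ[R] W} (hU : U ≤ U'.comap j) {a : V} (ha : a ∈ LinearMap.range φ) (haU : j a ∈ U')
    {ℓ : V →ₗ[R] R} (hℓ : ℓ a ≠ 0)
    (hrange : ∀ v ∈ LinearMap.range φ, ℓ v = 0 → j v ∈ LinearMap.range ψ) (f : V) :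
    ψ (j f) = j (φ f - (ℓ (φ f) / ℓ a) • a) := by
  set c := ℓ (φ f) / ℓ a
  have hv : φ f - c • a ∈ LinearMap.range φ :=
    Submodule.sub_mem _ (LinearMap.mem_range_self φ f) (Submodule.smul_mem _ c ha)
  have hℓv : ℓ (φ f - c • a) = 0 := by
    rw [map_sub, map_smul, smul_eq_mul, div_mul_cancel₀ _ hℓ, sub_self]
  have hsub : j f - j (φ f - c • a) ∈ U' := by
    have hdecomp : j f - j (φ f - c • a) = j (f - φ f) + c • j a := by
      simp only [map_sub, map_smul]
      abel
    rw [hdecomp]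
    exact add_mem (hU (hφ.sub_mem f)) (Submodule.smul_mem _ c haU)
  rw [hψ.apply_eq_apply_iff.2 hsub, hψ.mem_range_iff.1 (hrange _ hv hℓv)]

end IsCompleteReduction

end LinearAlgebra

variable {C E ι : Type*} [Field C] [Field E] [Algebra C E] {σ : E ≃ₐ[C] E}

section Subfields

variable {K L : IntermediateField C E}

theorem mem_summableSpace {x : K} : x ∈ summableSpace σ K ↔ ∃ y ∈ K, delta σ y = x :=
  Iff.rfl

theorem summableSpace_le_comap_inclusion (h : K ≤ L) :
    summableSpace σ K ≤
      (summableSpace σ L).comap (IntermediateField.inclusion h).toLinearMap := by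
  rintro x ⟨y, hy, hyx⟩
  exact ⟨y, h hy, hyx⟩

theorem zero_mem_properComplement (s : E) (S : Set K[X]) : (0 : E) ∈ properComplement K s S :=
  ⟨0, 1, one_mem _, by simp, by simp⟩

theorem coe_mem_polyComplement (s : E) {φ : K →ₗ[C] K} {ℓ : K →ₗ[C] C} {v : K}
    (hv : v ∈ LinearMap.range φ) (hℓ : ℓ v = 0) : (v : E) ∈ polyComplement K s φ ℓ := by
  refine ⟨Polynomial.C v, fun k => ?_, (Polynomial.aeval_C s v).symm⟩
  rw [Polynomial.coeff_C]
  split_ifs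
  · exact ⟨hv, hℓ⟩
  · exact ⟨zero_mem _, map_zero _⟩

theorem one_mem_fractionBasis (K : IntermediateField C E) (s : E) : (1 : E) ∈ fractionBasis K s :=
  Or.inl ⟨0, (pow_zero s).symm⟩

end Subfields

variable {F₀ : IntermediateField C E} {t : ℕ → E}

theorem towerField_mono : Monotone (towerField F₀ t) :=
  monotone_nat_of_le_succ fun i x hx =>
    (IntermediateField.adjoin (towerField F₀ t i) {t i}).algebraMap_mem ⟨x, hx⟩

theorem base_le_towerField (i : ℕ) : F₀ ≤ towerField F₀ t i :=
  towerField_mono i.zero_le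

theorem generator_mem_towerField_succ (i : ℕ) : t i ∈ towerField F₀ t (i + 1) :=
  IntermediateField.mem_adjoin_simple_self (towerField F₀ t i) (t i)

theorem ind_eq_zero_iff {f : E} {i : ℕ} (hf : f ∈ towerField F₀ t i) :
    ind F₀ t f = 0 ↔ f ∈ F₀ :=
  Nat.sInf_eq_zero.trans
    (or_iff_left (Set.nonempty_iff_ne_empty.1 ⟨i, hf⟩))

theorem base_mem_canonicalBasis (Θ₀ : Module.Basis ι C F₀) (t : ℕ → E) (k : ι) (i : ℕ) :
    (Θ₀ k : E) ∈ canonicalBasis Θ₀ t i := by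
  induction i with
  | zero => exact ⟨k, rfl⟩
  | succ i ih => exact ⟨_, ih, 1, one_mem_fractionBasis _ _, (mul_one _).symm⟩

theorem thetaStar_apply_of_mem_base (Θ₀ : Module.Basis ι C F₀) {i : ℕ} {θ f : towerField F₀ t i}
    (hθ : (θ : E) ∉ F₀) (hf : (f : E) ∈ F₀) : thetaStar Θ₀ t i θ f = 0 := by
  let base : F₀ →ₗ[C] towerField F₀ t i :=
    (IntermediateField.inclusion (base_le_towerField i)).toLinearMap
  have hcomp : thetaStar Θ₀ t i θ ∘ₗ base = 0 := by
    refine Θ₀.ext fun k => dualFunctional_apply_of_ne (base_mem_canonicalBasis Θ₀ t k i) ?_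
    rintro rfl
    exact hθ (Θ₀ k).2
  exact LinearMap.congr_fun hcomp ⟨f, hf⟩

namespace IsReductionSystem

variable {n : ℕ} {Θ₀ : Module.Basis ι C F₀} {S : ∀ i : ℕ, Set (towerField F₀ t i)[X]}
  {θ : ∀ i : ℕ, towerField F₀ t i} {φ : ∀ i : ℕ, towerField F₀ t i →ₗ[C] towerField F₀ t i}
  {i : ℕ} {a : towerField F₀ t i}

theorem inclusion_mem_range_succ (hφ : IsReductionSystem σ F₀ t n Θ₀ S θ φ) (hi : i < n)
    {v : towerField F₀ t i} (hv : v ∈ LinearMap.range (φ i))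
    (hθv : thetaStar Θ₀ t i (θ i) v = 0) :
    IntermediateField.inclusion (towerField_mono i.le_succ) v ∈ LinearMap.range (φ (i + 1)) :=
  (hφ.range_succ i hi _).2 ⟨0, zero_mem_properComplement _ _, v,
    coe_mem_polyComplement _ hv hθv, (zero_add _).symm⟩

theorem apply_succ_inclusion (hφ : IsReductionSystem σ F₀ t n Θ₀ S θ φ) (hi : i < n)
    (ha : a ∈ LinearMap.range (φ i)) (hat : (a : E) = delta σ (t i)) (f : towerField F₀ t i) :
    φ (i + 1) (IntermediateField.inclusion (towerField_mono i.le_succ) f) =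
      IntermediateField.inclusion (towerField_mono i.le_succ)
        (φ i f - (thetaStar Θ₀ t i (θ i) (φ i f) / thetaStar Θ₀ t i (θ i) a) • a) := by
  have hred := hφ.completeReduction i hi.le
  have hθa : thetaStar Θ₀ t i (θ i) a ≠ 0 := by
    simpa only [hred.mem_range_iff.1 ha] using hφ.theta_effective i hi a hat
  exact hred.apply_map_eq (hφ.completeReduction (i + 1) hi)
    (summableSpace_le_comap_inclusion (towerField_mono i.le_succ)) ha
    (mem_summableSpace.2 ⟨t i, generator_mem_towerField_succ i, hat.symm⟩) hθa
    (fun _ => hφ.inclusion_mem_range_succ hi) f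

theorem theta_mem_base_iff (hφ : IsReductionSystem σ F₀ t n Θ₀ S θ φ) (hi : i < n)
    (ha : a ∈ LinearMap.range (φ i)) (hat : (a : E) = delta σ (t i)) :
    (θ i : E) ∈ F₀ ↔ (a : E) ∈ F₀ := by
  rw [← ind_eq_zero_iff (θ i).2, hφ.theta_ind i hi a hat,
    (hφ.completeReduction i hi.le).mem_range_iff.1 ha, ind_eq_zero_iff a.2]

theorem apply_mem_base (hφ : IsReductionSystem σ F₀ t n Θ₀ S θ φ)
    (hW : IsWellGenerated σ F₀ t n φ) (hi : i ≤ n) {f : towerField F₀ t i} (hf : (f : E) ∈ F₀) :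
    (φ i f : E) ∈ F₀ := by
  induction i with
  | zero => exact (φ 0 f).2
  | succ i ih =>
    obtain ⟨a, ha, hat⟩ := hW i hi
    let f' : towerField F₀ t i := ⟨f, base_le_towerField i hf⟩
    have hφf' : (φ i f' : E) ∈ F₀ := ih (Nat.le_of_succ_le hi) hf
    have hmultiple :
        ((thetaStar Θ₀ t i (θ i) (φ i f') / thetaStar Θ₀ t i (θ i) a) • a : E) ∈ F₀ := by
      by_cases haF : (a : E) ∈ F₀
      · exact F₀.smul_mem haF
      · have hθ : (θ i : E) ∉ F₀ := (hφ.theta_mem_base_iff hi ha hat).not.2 haF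
        rw [thetaStar_apply_of_mem_base Θ₀ hθ hφf', zero_div, zero_smul]
        exact zero_mem F₀
    have hsucc := congrArg Subtype.val (hφ.apply_succ_inclusion hi ha hat f')
    exact hsucc ▸ sub_mem hφf' hmultiple

end IsReductionSystem

end SigmaTower

open SigmaTower in
theorem mainTheorem10_general {C E ι : Type*} [Field C] [Field E] [Algebra C E] {σ : E ≃ₐ[C] E}
    {F₀ : IntermediateField C E} {n : ℕ} {t : ℕ → E} {Θ₀ : Module.Basis ι C F₀}
    {S : ∀ i : ℕ, Set (Polynomial (towerField F₀ t i))} {θ : ∀ i : ℕ, towerField F₀ t i}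
    {φ : ∀ i : ℕ, towerField F₀ t i →ₗ[C] towerField F₀ t i}
    (hφ : IsReductionSystem σ F₀ t n Θ₀ S θ φ) (hW : IsWellGenerated σ F₀ t n φ) :
    IsReduced σ F₀ t n := by
  rintro i hi ⟨g, hg, r, hr, hgr⟩
  obtain ⟨a, ha, hat⟩ := hW i hi
  let r' : towerField F₀ t i := ⟨r, base_le_towerField i hr⟩
  have hred := hφ.completeReduction i hi.le
  have hsub : a - r' ∈ summableSpace σ (towerField F₀ t i) :=
    mem_summableSpace.2 ⟨g, hg, eq_sub_of_add_eq (hgr.symm.trans hat.symm)⟩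
  have har : a = φ i r' := by
    rw [← hred.apply_eq_apply_iff.2 hsub, hred.mem_range_iff.1 ha]
  rw [← hat, har]
  exact hφ.apply_mem_base hW hi.le hr

theorem mainTheorem10 {C E ι : Type*} [Field C] [CharZero C] [Field E] [Algebra C E]
    (σ : E ≃ₐ[C] E) (F₀ : IntermediateField C E) (n : ℕ) (t : ℕ → E)
    (hT : SigmaTower.IsSigmaTower σ F₀ t n)
    (Θ₀ : Module.Basis ι C F₀)
    (S : ∀ i : ℕ, Set (Polynomial (SigmaTower.towerField F₀ t i)))
    (θ : ∀ i : ℕ, SigmaTower.towerField F₀ t i)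
    (φ : ∀ i : ℕ, SigmaTower.towerField F₀ t i →ₗ[C] SigmaTower.towerField F₀ t i)
    (hφ : SigmaTower.IsReductionSystem σ F₀ t n Θ₀ S θ φ)
    (hW : SigmaTower.IsWellGenerated σ F₀ t n φ) :
    SigmaTower.IsReduced σ F₀ t n :=
  mainTheorem10_general hφ hW
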